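/- Let $n$ be a positive integer. In an additive category $\mathcal M$, call a sequence $X^0\xrightarrow{d^0}X^1\xrightarrow{d^1}\cdots\xrightarrow{d^{n-1}}X^n\xrightarrow{d^n}X^{n+1}$ left $n$-exact (equivalently, $(d^0,\dots,d^{n-1})$ is an $n$-kernel of $d^n$) if for every object $Y$ of $\mathcal M$ the sequence of abelian groups $$0\to\mathcal M(Y,X^0)\to\mathcal M(Y,X^1)\to\cdots\to\mathcal M(Y,X^{n+1})$$ is exact. Dually, call it right $n$-exact (equivalently, $(d^1,\dots,d^n)$ is an $n$-cokernel of $d^0$) if $0\to\mathcal M(X^{n+1},Y)\to\cdots\to\mathcal M(X^1,Y)\to\mathcal M(X^0,Y)$ is exact for every $Y$, and $n$-exact if it is both left and right $n$-exact. An additive category $\mathcal M$ is $n$-abelian if it is idempotent complete, every morphism has an $n$-kernel and an $n$-cokernel, every sequence formed by a monomorphism $d^0$ followed by an $n$-cokernel $(d^1,\dots,d^n)$ of it is $n$-exact, and every sequence formed by an epimorphism $d^n$ preceded by an $n$-kernel $(d^0,\dots,d^{n-1})$ of it is $n$-exact. Let $\mathcal M$ be a small $n$-abelian category and $\mathrm{Ab}$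 the category of abelian groups. A mono functor is an additive functor $\mathcal M\to\mathrm{Ab}$ that preserves monomorphisms. A mono functor $M$ is absolutely pure if for every mono functor $N$ containing $M$ as a subfunctor, the quotient functor $N/M$ is again a mono functor. Theorem. A mono functor $M:\mathcal M\to\mathrm{Ab}$ is absolutely pure if and only if for every left $n$-exact sequence $X^0\to X^1\to\cdots\to X^n\to X^{n+1}$ in $\mathcal M$, the sequence $$0\to M(X^0)\to M(X^1)\to M(X^2)$$ of abelian groups is exact. -/

import Mathlib

open CategoryTheory CategoryTheory.Limits

universe u v

namespace NAbelian

section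

variable {C : Type u} [Category.{v} C] [Preadditive C]

/-- A sequence `X⁰ ⟶ X¹ ⟶ ⋯ ⟶ Xⁿ ⟶ Xⁿ⁺¹` is left `n`-exact, that is, `(d⁰, …, dⁿ⁻¹)` is an
`n`-kernel of `dⁿ`: for every object `Y` the sequence of abelian groups
`0 ⟶ Hom(Y, X⁰) ⟶ Hom(Y, X¹) ⟶ ⋯ ⟶ Hom(Y, Xⁿ) ⟶ Hom(Y, Xⁿ⁺¹)` is exact.
In particular `X` is a complex. -/
structure IsLeftNExact {n : ℕ} (X : ComposableArrows C (n + 1)) : Prop where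
  injective : ∀ Y : C, Function.Injective
    (fun f : Y ⟶ X.obj' 0 => f ≫ X.map' 0 1)
  exact : ∀ (Y : C) (i : ℕ) (hi : i < n), Function.Exact
    (fun f : Y ⟶ X.obj' i => f ≫ X.map' i (i + 1))
    (fun f : Y ⟶ X.obj' (i + 1) => f ≫ X.map' (i + 1) (i + 2))

/-- A sequence `X⁰ ⟶ X¹ ⟶ ⋯ ⟶ Xⁿ ⟶ Xⁿ⁺¹` is right `n`-exact, that is, `(d¹, …, dⁿ)` is an
`n`-cokernel of `d⁰`: for every object `Y` the sequence of abelian groups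
`0 ⟶ Hom(Xⁿ⁺¹, Y) ⟶ Hom(Xⁿ, Y) ⟶ ⋯ ⟶ Hom(X¹, Y) ⟶ Hom(X⁰, Y)` is exact. -/
structure IsRightNExact {n : ℕ} (X : ComposableArrows C (n + 1)) : Prop where
  injective : ∀ Y : C, Function.Injective
    (fun f : X.obj' (n + 1) ⟶ Y => X.map' n (n + 1) ≫ f)
  exact : ∀ (Y : C) (i : ℕ) (hi : i < n), Function.Exact
    (fun f : X.obj' (i + 2) ⟶ Y => X.map' (i + 1) (i + 2) ≫ f)
    (fun f : X.obj' (i + 1) ⟶ Y => X.map' i (i + 1) ≫ f)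

/-- An `n`-exact sequence is one that is both left and right `n`-exact. -/
def IsNExact {n : ℕ} (X : ComposableArrows C (n + 1)) : Prop :=
  IsLeftNExact X ∧ IsRightNExact X

/-- `f` has an `n`-kernel: it is the last morphism of a left `n`-exact sequence. -/
def HasNKernel (n : ℕ) {A B : C} (f : A ⟶ B) : Prop :=
  ∃ X : ComposableArrows C (n + 1),
    Arrow.mk (X.map' n (n + 1)) = Arrow.mk f ∧ IsLeftNExact X

/-- `f` has an `n`-cokernel: it is the first morphism of a right `n`-exact sequence. -/
def HasNCokernel (n : ℕ) {A B : C} (f : A ⟶ B) : Prop :=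
  ∃ X : ComposableArrows C (n + 1),
    Arrow.mk (X.map' 0 1) = Arrow.mk f ∧ IsRightNExact X

end

/-- `n`-abelian categories (used for `n ≥ 1`): additive categories with the axioms (A0)–(A3). -/
structure IsNAbelian (n : ℕ) (C : Type u) [Category.{v} C] [Preadditive C] : Prop where
  /-- With `Preadditive C`, this says that `C` is additive (zero object and finite sums). -/
  hasFiniteBiproducts : HasFiniteBiproducts C
  isIdempotentComplete : IsIdempotentComplete C
  hasNKernel : ∀ {A B : C} (f : A ⟶ B), HasNKernel n f
  hasNCokernel : ∀ {A B : C} (f : A ⟶ B), HasNCokernel n f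
  /-- A monomorphism followed by any of its `n`-cokernels is an `n`-exact sequence. -/
  nExact_of_mono : ∀ X : ComposableArrows C (n + 1),
    Mono (X.map' 0 1) → IsRightNExact X → IsNExact X
  /-- An epimorphism preceded by any of its `n`-kernels is an `n`-exact sequence. -/
  nExact_of_epi : ∀ X : ComposableArrows C (n + 1),
    Epi (X.map' n (n + 1)) → IsLeftNExact X → IsNExact X

section

variable {C : Type u} [Category.{v} C] [Preadditive C]

/-- A mono functor: an additive functor to abelian groups which preserves monomorphisms. -/
structure IsMonoFunctor (F : C ⥤ Ab.{u}) : Prop where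
  additive : F.Additive
  preservesMonomorphisms : F.PreservesMonomorphisms

/-- For a monomorphism `ι : F ⟶ N` of functors, exhibiting `F` as a subfunctor of the mono
functor `N`, the subfunctor is pure if the quotient functor `N / F` is a mono functor. -/
def IsPureSubfunctor {F N : C ⥤ Ab.{u}} (ι : F ⟶ N) : Prop :=
  IsMonoFunctor (cokernel ι)

/-- A mono functor is absolutely pure if it is pure in every mono functor in which it appears
as a subfunctor. -/
structure IsAbsolutelyPure (F : C ⥤ Ab.{u}) : Prop where
  isMonoFunctor : IsMonoFunctor F
  pure : ∀ (N : C ⥤ Ab.{u}) (ι : F ⟶ N), IsMonoFunctor N → Mono ι → IsPureSubfunctor ι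

end

end NAbelian

namespace NAbelian

/-! ### Weak cokernels, weak pushouts and coimages. -/

section

variable {C : Type u} [Category.{v} C] [Preadditive C] {n : ℕ}

/-! Suppose `M` is exact on left `n`-exact sequences. A monomorphism `f` followed by an `n`-cokernel
is such a sequence, so `M` is exact at the middle of `A ⟶ B ⟶ W`; a diagram chase then shows that
`M` is pure in every mono functor containing it (`isPureSubfunctor_of_exact`).

Conversely, let `m` in `M X₁` be killed by `d₁`. Then `m` is killed by every morphism that vanishes
on `d₀` (`IsMonoFunctor.map_eq_zero`). This is what is needed to embed `M` in a mono functor where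
`m` acquires a preimage under `d₀`: push out along `Hom(X₁, -) ⟶ Hom(X₀, -)` and divide by whatever
some monomorphism kills (`Extension.functor`). Purity of `M` there forces the preimage into `M`
(`IsAbsolutelyPure.exists_map_eq`). -/

/-- A monomorphism is the first morphism of an `n`-exact sequence. -/
lemma IsNAbelian.exists_nExact_of_mono (hC : IsNAbelian n C) {A B : C} (f : A ⟶ B) [Mono f] :
    ∃ X : ComposableArrows C (n + 1), Arrow.mk (X.map' 0 1) = Arrow.mk f ∧ IsNExact X := by
  obtain ⟨X, hX, hr⟩ := hC.hasNCokernel f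
  refine ⟨X, hX, hC.nExact_of_mono X ?_ hr⟩
  have : Mono (Arrow.mk f).hom := ‹Mono f›
  rw [← hX] at this
  exact this

/-- The first two terms of an `n`-cokernel of a monomorphism: `p` is a weak cokernel of `f`
with weak kernel `f`, it is epi if `n = 1`, and it has a weak cokernel with weak kernel `p`
otherwise. -/
lemma IsNAbelian.exists_nCokernel_of_mono (hC : IsNAbelian n C) (hn : 0 < n)
    {A B : C} (f : A ⟶ B) [Mono f] :
    ∃ (W : C) (p : B ⟶ W),
      (∀ (Z : C) (z : Z ⟶ B), z ≫ p = 0 ↔ ∃ a, a ≫ f = z) ∧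
      (∀ (Z : C) (g : B ⟶ Z), f ≫ g = 0 ↔ ∃ g', p ≫ g' = g) ∧
      (n = 1 → Epi p) ∧
      (1 < n → ∃ (V : C) (q : W ⟶ V), ∀ (Z : C) (z : Z ⟶ W), z ≫ q = 0 ↔ ∃ y, y ≫ p = z) := by
  obtain ⟨X, hX, hl, hr⟩ := hC.exists_nExact_of_mono f
  -- Phrased for arrows, so that rewriting along `hX` needs no casts between objects.
  let P : Arrow C → Prop := fun φ ↦ ∃ (W : C) (p : φ.right ⟶ W),
      (∀ (Z : C) (z : Z ⟶ φ.right), z ≫ p = 0 ↔ ∃ a, a ≫ φ.hom = z) ∧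
      (∀ (Z : C) (g : φ.right ⟶ Z), φ.hom ≫ g = 0 ↔ ∃ g', p ≫ g' = g) ∧
      (n = 1 → Epi p) ∧
      (1 < n → ∃ (V : C) (q : W ⟶ V), ∀ (Z : C) (z : Z ⟶ W), z ≫ q = 0 ↔ ∃ y, y ≫ p = z)
  suffices P (Arrow.mk f) from this
  rw [← hX]
  refine ⟨X.obj' 2, X.map' 1 2, fun Z z ↦ hl.exact Z 0 hn z, fun Z g ↦ hr.exact Z 0 hn g, ?_,
    fun h1 ↦ ⟨X.obj' 3, X.map' 2 3, fun Z z ↦ hl.exact Z 1 h1 z⟩⟩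
  rintro rfl
  exact ⟨fun g h e ↦ hr.injective _ e⟩

/-- Monomorphisms are stable under weak pushouts. -/
lemma IsNAbelian.exists_mono_comm (hC : IsNAbelian n C) (hn : 0 < n)
    {A B A' : C} (f : A ⟶ B) [Mono f] (g : A ⟶ A') :
    ∃ (B' : C) (f' : A' ⟶ B') (g' : B ⟶ B'), Mono f' ∧ g ≫ f' = f ≫ g' := by
  have := hC.hasFiniteBiproducts
  have := hasBinaryBiproducts_of_finite_biproducts C
  have : Mono (biprod.lift f (-g)) := mono_of_mono_fac (biprod.lift_fst f (-g))
  obtain ⟨W, p, hp, -⟩ := hC.exists_nCokernel_of_mono hn (biprod.lift f (-g))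
  refine ⟨W, biprod.inr ≫ p, biprod.inl ≫ p, Preadditive.mono_of_cancel_zero _ ?_, ?_⟩
  · intro Z z hz
    -- Since `(f, -g)` is a weak kernel of `p`, the map `(0, z)` factors through it by some `a`;
    -- then `a ≫ f = 0` forces `a = 0`.
    obtain ⟨a, ha⟩ := (hp Z (z ≫ biprod.inr)).1 (by simpa using hz)
    have h1 : a ≫ f = 0 := by simpa using ha =≫ biprod.fst
    have h2 : a = 0 := by rwa [← cancel_mono f, zero_comp]
    simpa [h2] using (ha =≫ biprod.snd).symm
  · have := (hp _ (biprod.lift f (-g))).2 ⟨𝟙 _, by simp⟩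
    rw [biprod.lift_eq, Preadditive.add_comp, Preadditive.neg_comp, Preadditive.neg_comp,
      add_neg_eq_zero] at this
    simpa using this.symm

/-- In a `1`-abelian category, the canonical morphism from the coimage is a monomorphism. -/
lemma IsNAbelian.mono_of_epi_comp (hC : IsNAbelian 1 C) {X₀ X₁ X₂ Y : C}
    (d₀ : X₀ ⟶ X₁) (d₁ : X₁ ⟶ X₂) [Mono d₀]
    (hd : ∀ (Z : C) (z : Z ⟶ X₁), z ≫ d₁ = 0 ↔ ∃ a, a ≫ d₀ = z)
    (p : X₁ ⟶ Y) [Epi p] (hp : d₀ ≫ p = 0) (h : Y ⟶ X₂) (ph : p ≫ h = d₁) : Mono h := by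
  obtain ⟨K, k, hk, hk'⟩ : ∃ (K : C) (k : K ⟶ Y), Mono k ∧
      ∀ (Z : C) (z : Z ⟶ Y), z ≫ h = 0 ↔ ∃ a, a ≫ k = z := by
    obtain ⟨X, hX, hl⟩ := hC.hasNKernel h
    let P : Arrow C → Prop := fun φ ↦ ∃ (K : C) (k : K ⟶ φ.left), Mono k ∧
      ∀ (Z : C) (z : Z ⟶ φ.left), z ≫ φ.hom = 0 ↔ ∃ a, a ≫ k = z
    suffices P (Arrow.mk h) from this
    rw [← hX]
    exact ⟨X.obj' 0, X.map' 0 1, ⟨fun a b e ↦ hl.injective _ e⟩,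
      fun Z z ↦ hl.exact Z 0 Nat.one_pos z⟩
  obtain ⟨Q, c, hc, hc', hQ, -⟩ := hC.exists_nCokernel_of_mono Nat.one_pos k
  have kc : k ≫ c = 0 := (hc _ k).2 ⟨𝟙 _, by simp⟩
  obtain ⟨h', ch⟩ := (hc' _ h).1 ((hk' _ k).2 ⟨𝟙 _, by simp⟩)
  have := hQ rfl
  -- As `h` factors through `c`, the epimorphism `p ≫ c` still has kernel `d₀`, hence is a cokernel
  -- of `d₀`. So `p` factors through `p ≫ c`, which splits `c` and forces `k = 0`.
  let X : ComposableArrows C 2 := .mk₂ d₀ (p ≫ c)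
  have hX : IsLeftNExact (n := 1) X := by
    refine ⟨fun Z a b e ↦ (cancel_mono d₀).1 e, fun Z i hi ↦ ?_⟩
    obtain rfl : i = 0 := by omega
    suffices ∀ z : Z ⟶ X₁, z ≫ p ≫ c = 0 ↔ ∃ a, a ≫ d₀ = z from this
    intro z
    refine ⟨fun hz ↦ (hd _ _).1 ?_, ?_⟩
    · rw [← ph, ← ch, ← Category.assoc p, ← Category.assoc z, hz, zero_comp]
    · rintro ⟨a, rfl⟩
      rw [Category.assoc, reassoc_of% hp, zero_comp, comp_zero]
  have hXe : Epi (X.map' 1 2) := epi_comp p c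
  obtain ⟨r, hr⟩ : ∃ r : Q ⟶ Y, (p ≫ c) ≫ r = p :=
    ((hC.nExact_of_epi X hXe hX).2.exact Y 0 Nat.one_pos p).1 hp
  have cr : c ≫ r = 𝟙 Y := by
    rw [← cancel_epi p, Category.comp_id, ← Category.assoc, hr]
  refine Preadditive.mono_of_cancel_zero _ fun z hz ↦ ?_
  obtain ⟨a, rfl⟩ := (hk' _ z).1 hz
  rw [← Category.comp_id k, ← cr, reassoc_of% kc, zero_comp, comp_zero]

end

section

variable {C : Type u} [SmallCategory C]

lemma cokernel_π_app_surjective {F N : C ⥤ Ab.{u}} (ι : F ⟶ N) (Z : C) :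
    Function.Surjective ((cokernel.π ι).app Z) :=
  (AddCommGrpCat.epi_iff_surjective _).1 inferInstance

lemma cokernel_π_app_eq_zero_iff {F N : C ⥤ Ab.{u}} (ι : F ⟶ N) (Z : C) (x : N.obj Z) :
    (cokernel.π ι).app Z x = 0 ↔ ∃ a, ι.app Z a = x := by
  have h : (ShortComplex.mk ι (cokernel.π ι) (cokernel.condition ι)).Exact :=
    ShortComplex.exact_of_g_is_cokernel _ (cokernelIsCokernel ι)
  have h' := h.map ((evaluation C Ab.{u}).obj Z)
  rw [ShortComplex.ab_exact_iff_function_exact] at h'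
  exact h' x

end

/-! ### Elements of mono functors killed by a morphism. -/

section

variable {C : Type u} [SmallCategory C] [Preadditive C] {n : ℕ}

lemma IsMonoFunctor.injective_map {M : C ⥤ Ab.{u}} (hM : IsMonoFunctor M) {A B : C}
    (f : A ⟶ B) [Mono f] : Function.Injective (M.map f) := by
  have := hM.preservesMonomorphisms
  exact (AddCommGrpCat.mono_iff_injective _).1 inferInstance

/-- Elements of a mono functor killed by the second morphism of a left `n`-exact sequence
are killed by every morphism whose composition with the first one is zero. -/
lemma IsMonoFunctor.map_eq_zero (hC : IsNAbelian n C) (hn : 0 < n) {M : C ⥤ Ab.{u}}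
    (hM : IsMonoFunctor M) {X₀ X₁ X₂ : C} (d₀ : X₀ ⟶ X₁) (d₁ : X₁ ⟶ X₂) [Mono d₀]
    (hd : ∀ (Z : C) (z : Z ⟶ X₁), z ≫ d₁ = 0 ↔ ∃ a, a ≫ d₀ = z)
    (m : M.obj X₁) (hm : M.map d₁ m = 0) {Z : C} (g : X₁ ⟶ Z) (hg : d₀ ≫ g = 0) :
    M.map g m = 0 := by
  have := hC.hasFiniteBiproducts
  have := hasBinaryBiproducts_of_finite_biproducts C
  have := hM.additive
  obtain ⟨W, p, hp, hp', hW₁, hW₂⟩ := hC.exists_nCokernel_of_mono hn d₀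
  have d₀p : d₀ ≫ p = 0 := (hp _ d₀).2 ⟨𝟙 _, by simp⟩
  have d₀d₁ : d₀ ≫ d₁ = 0 := (hd _ d₀).2 ⟨𝟙 _, by simp⟩
  obtain ⟨h, rfl⟩ := (hp' _ d₁).1 d₀d₁
  obtain ⟨g, rfl⟩ := (hp' _ g).1 hg
  suffices M.map p m = 0 by simp [this]
  obtain rfl | h1 : n = 1 ∨ 1 < n := by omega
  · have := hW₁ rfl
    have := hC.mono_of_epi_comp d₀ _ hd p d₀p h rfl
    apply hM.injective_map h
    simpa using hm
  · obtain ⟨V, q, hq⟩ := hW₂ h1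
    have pq : p ≫ q = 0 := (hq _ p).2 ⟨𝟙 _, by simp⟩
    -- A map killed by `q` has the form `y ≫ p`; if `h` kills it too, `y` factors through `d₀`, and
    -- `d₀ ≫ p = 0`.
    have : Mono (biprod.lift h q) := by
      refine Preadditive.mono_of_cancel_zero _ fun z hz ↦ ?_
      have h1 : z ≫ h = 0 := by simpa using hz =≫ biprod.fst
      have h2 : z ≫ q = 0 := by simpa using hz =≫ biprod.snd
      obtain ⟨y, rfl⟩ := (hq _ z).1 h2
      obtain ⟨a, rfl⟩ := (hd _ y).1 (by simpa using h1)
      rw [Category.assoc, d₀p, comp_zero]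
    apply hM.injective_map (biprod.lift h q)
    rw [map_zero, ← ConcreteCategory.comp_apply, ← M.map_comp, biprod.lift_eq,
      Preadditive.comp_add, reassoc_of% pq, zero_comp, add_zero, ← Category.assoc, M.map_comp,
      ConcreteCategory.comp_apply, hm, map_zero]

/-! ### The mono extension of `M` in which `m` becomes divisible by `d`. -/

namespace Extension

/-- The action of a morphism on `M Z × Hom(X₀, Z)`. -/
def prodMap (M : C ⥤ Ab.{u}) {X₀ Z Z' : C} (u : Z ⟶ Z') :
    M.obj Z × (X₀ ⟶ Z) →+ M.obj Z' × (X₀ ⟶ Z') :=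
  AddMonoidHom.prodMap (M.map u).hom (Preadditive.rightComp X₀ u)

lemma prodMap_apply (M : C ⥤ Ab.{u}) {X₀ Z Z' : C} (u : Z ⟶ Z') (x : M.obj Z × (X₀ ⟶ Z)) :
    prodMap M u x = (M.map u x.1, x.2 ≫ u) := rfl

variable (hC : IsNAbelian n C) (hn : 0 < n) (M : C ⥤ Ab.{u}) [M.Additive]
  {X₀ X₁ : C} (d : X₀ ⟶ X₁) (m : M.obj X₁)

/-- The elements of `M Z × Hom(X₀, Z)` that become zero, after a monomorphism `Z ⟶ W`, in the
pushout of `M` and `Hom(X₀, -)` along `m : Hom(X₁, -) ⟶ M` and `d`. -/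
def relations (Z : C) : AddSubgroup (M.obj Z × (X₀ ⟶ Z)) where
  carrier := {x | ∃ (W : C) (f : Z ⟶ W) (k : X₁ ⟶ W), Mono f ∧ x.2 ≫ f = d ≫ k ∧
    M.map f x.1 = - M.map k m}
  zero_mem' := ⟨Z, 𝟙 Z, 0, inferInstance, by simp, by simp [M.map_zero]⟩
  neg_mem' := by
    rintro ⟨a, g⟩ ⟨W, f, k, hf, h1, h2⟩
    refine ⟨W, f, -k, hf, ?_, ?_⟩
    · simpa using h1
    · dsimp at h2 ⊢
      rw [map_neg, h2, M.map_neg]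
      rfl
  add_mem' := by
    rintro ⟨a, g⟩ ⟨b, g'⟩ ⟨W, f, k, hf, h1, h2⟩ ⟨W', f', k', hf', h1', h2'⟩
    -- The weak pushout of `f` along `f'` provides one monomorphism out of `Z` that witnesses both
    -- relations.
    obtain ⟨V, s, t, hs, hst⟩ := hC.exists_mono_comm hn f f'
    refine ⟨V, f' ≫ s, k ≫ t + k' ≫ s, mono_comp _ _, ?_, ?_⟩
    · dsimp at h1 h1' ⊢
      rw [Preadditive.add_comp, Preadditive.comp_add, reassoc_of% h1', hst, reassoc_of% h1]
    · dsimp at h2 h2' ⊢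
      rw [map_add, M.map_add]
      nth_rewrite 1 [hst]
      simp only [M.map_comp, ConcreteCategory.comp_apply, h2, h2', map_neg]
      change _ = - (M.map t (M.map k m) + M.map s (M.map k' m))
      abel

lemma relations_map {Z Z' : C} (u : Z ⟶ Z') {x : M.obj Z × (X₀ ⟶ Z)}
    (hx : x ∈ relations hC hn M d m Z) :
    (M.map u x.1, x.2 ≫ u) ∈ relations hC hn M d m Z' := by
  obtain ⟨W, f, k, hf, h1, h2⟩ := hx
  obtain ⟨V, s, t, hs, hst⟩ := hC.exists_mono_comm hn f u
  refine ⟨V, s, k ≫ t, hs, ?_, ?_⟩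
  · dsimp
    rw [Category.assoc, hst, reassoc_of% h1]
  · dsimp
    rw [← ConcreteCategory.comp_apply, ← M.map_comp, hst]
    simp [h2]

/-- The quotient of `M × Hom(X₀, -)` by the relations: the largest mono quotient of the pushout
of `M` and `Hom(X₀, -)` along `m : Hom(X₁, -) ⟶ M` and `d`. -/
noncomputable def functor : C ⥤ Ab.{u} where
  obj Z := AddCommGrpCat.of ((M.obj Z × (X₀ ⟶ Z)) ⧸ relations hC hn M d m Z)
  map {Z Z'} u := AddCommGrpCat.ofHom (QuotientAddGroup.map _ _ (prodMap M u)
    fun _ hx ↦ relations_map hC hn M d m u hx)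
  map_id Z := by
    ext x
    change QuotientAddGroup.mk (prodMap M (𝟙 Z) x) = QuotientAddGroup.mk x
    simp [prodMap_apply]
  map_comp u v := by
    ext x
    change QuotientAddGroup.mk (prodMap M (u ≫ v) x) =
      QuotientAddGroup.mk (prodMap M v (prodMap M u x))
    simp [prodMap_apply]

/-- The class in the extension of an element of `M Z × Hom(X₀, Z)`. -/
noncomputable def mk {Z : C} : M.obj Z × (X₀ ⟶ Z) →+ (functor hC hn M d m).obj Z :=
  QuotientAddGroup.mk' (relations hC hn M d m Z)

lemma mk_surjective {Z : C} :
    Function.Surjective (mk hC hn M d m : M.obj Z × (X₀ ⟶ Z) →+ _) :=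
  QuotientAddGroup.mk_surjective

lemma mk_eq_zero_iff {Z : C} (x : M.obj Z × (X₀ ⟶ Z)) :
    mk hC hn M d m x = 0 ↔ x ∈ relations hC hn M d m Z :=
  QuotientAddGroup.eq_zero_iff x

lemma functor_map_mk {Z Z' : C} (u : Z ⟶ Z') (x : M.obj Z × (X₀ ⟶ Z)) :
    (functor hC hn M d m).map u (mk hC hn M d m x) =
      mk hC hn M d m (M.map u x.1, x.2 ≫ u) := rfl

/-- Monomorphisms are preserved because the relations are saturated: if `f` witnesses that the image
under a monomorphism `u` vanishes, then `u ≫ f` witnesses it for the element itself. -/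
lemma isMonoFunctor_functor : IsMonoFunctor (functor hC hn M d m) where
  additive := ⟨fun {Z Z' u v} ↦ by
    ext x
    obtain ⟨x, rfl⟩ := mk_surjective hC hn M d m x
    change (functor hC hn M d m).map (u + v) (mk hC hn M d m x) =
      (functor hC hn M d m).map u (mk hC hn M d m x) +
        (functor hC hn M d m).map v (mk hC hn M d m x)
    simp only [functor_map_mk, ← map_add, M.map_add, Preadditive.comp_add]
    rfl⟩
  preservesMonomorphisms := ⟨fun {Z Z'} u _ ↦ by
    rw [AddCommGrpCat.mono_iff_injective, injective_iff_map_eq_zero]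
    intro x hx
    obtain ⟨x, rfl⟩ := mk_surjective hC hn M d m x
    rw [functor_map_mk, mk_eq_zero_iff] at hx
    obtain ⟨W, f, k, hf, h1, h2⟩ := hx
    rw [mk_eq_zero_iff]
    exact ⟨W, u ≫ f, k, mono_comp _ _, by simpa using h1, by simpa using h2⟩⟩

/-- The inclusion of `M` in the extension. -/
noncomputable def ι : M ⟶ functor hC hn M d m where
  app Z := AddCommGrpCat.ofHom ((mk hC hn M d m).comp (AddMonoidHom.inl _ _))
  naturality Z Z' u := by
    ext a
    change mk hC hn M d m (M.map u a, 0) =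
      (functor hC hn M d m).map u (mk hC hn M d m (a, 0))
    rw [functor_map_mk, zero_comp]

lemma ι_app_apply {Z : C} (a : M.obj Z) :
    (ι hC hn M d m).app Z a = mk hC hn M d m (a, 0) := rfl

/-- A relation `(a, 0)` comes with some `k` such that `d ≫ k = 0`, so `hm` gives `M.map f a = 0` for
a monomorphism `f`. -/
lemma injective_ι_app (hM : IsMonoFunctor M)
    (hm : ∀ (W : C) (k : X₁ ⟶ W), d ≫ k = 0 → M.map k m = 0) (Z : C) :
    Function.Injective ((ι hC hn M d m).app Z) := by
  rw [injective_iff_map_eq_zero]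
  intro a ha
  rw [ι_app_apply, mk_eq_zero_iff] at ha
  obtain ⟨W, f, k, hf, h1, h2⟩ := ha
  apply hM.injective_map f
  dsimp at h1 h2
  rw [h2, hm _ k (by rw [← h1, zero_comp]), neg_zero, map_zero]

/-- The class of `(0, 𝟙 X₀)` is the adjoined preimage of `m`: the difference `(-m, d)` is the
relation with `f = k = 𝟙 X₁`. -/
lemma functor_map_mk_id :
    (functor hC hn M d m).map d (mk hC hn M d m (0, 𝟙 X₀)) = (ι hC hn M d m).app X₁ m := by
  rw [functor_map_mk, ι_app_apply, ← sub_eq_zero, ← map_sub, mk_eq_zero_iff]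
  exact ⟨X₁, 𝟙 X₁, 𝟙 X₁, inferInstance, by simp, by simp⟩

end Extension

/-! ### Purity and exactness. -/

lemma additive_cokernel {F N : C ⥤ Ab.{u}} (ι : F ⟶ N) [N.Additive] :
    (cokernel ι).Additive where
  map_add {Z Z' f g} := by
    rw [← cancel_epi ((cokernel.π ι).app Z), ← NatTrans.naturality, Preadditive.comp_add,
      ← NatTrans.naturality, ← NatTrans.naturality, N.map_add, Preadditive.add_comp]

/-- A subfunctor of a mono functor is pure if it is exact at the middle term of a complex
`A ⟶ B ⟶ W` for every monomorphism `A ⟶ B`. -/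
lemma isPureSubfunctor_of_exact {M N : C ⥤ Ab.{u}} (hN : IsMonoFunctor N) (ι : M ⟶ N) [Mono ι]
    (hM : ∀ {A B : C} (f : A ⟶ B), Mono f →
      ∃ (W : C) (p : B ⟶ W), f ≫ p = 0 ∧ Function.Exact (M.map f) (M.map p)) :
    IsPureSubfunctor ι := by
  have := hN.additive
  refine ⟨additive_cokernel ι, ⟨fun {A B} f hf ↦ ?_⟩⟩
  obtain ⟨W, p, fp, hp⟩ := hM f hf
  have hι (Z : C) : Function.Injective (ι.app Z) :=
    (AddCommGrpCat.mono_iff_injective _).1 inferInstance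
  rw [AddCommGrpCat.mono_iff_injective, injective_iff_map_eq_zero]
  intro x hx
  obtain ⟨x, rfl⟩ := cokernel_π_app_surjective ι A x
  rw [← NatTrans.naturality_apply, cokernel_π_app_eq_zero_iff] at hx
  obtain ⟨b, hb⟩ := hx
  -- In `N`, the element `b` is the image of `x` under `f`, and `f ≫ p = 0`.
  have hb' : M.map p b = 0 := by
    apply hι
    rw [NatTrans.naturality_apply, hb, ← ConcreteCategory.comp_apply, ← N.map_comp, fp,
      N.map_zero, map_zero]
    rfl
  obtain ⟨a, rfl⟩ := (hp b).1 hb'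
  rw [cokernel_π_app_eq_zero_iff]
  refine ⟨a, hN.injective_map f ?_⟩
  rw [← NatTrans.naturality_apply, hb]

/-- If `M` is absolutely pure, an element of `M X₁` that is killed by all morphisms with zero
composition with a monomorphism `d : X₀ ⟶ X₁` comes from `M X₀`. -/
lemma IsAbsolutelyPure.exists_map_eq (hC : IsNAbelian n C) (hn : 0 < n) {M : C ⥤ Ab.{u}}
    (hM : IsAbsolutelyPure M) {X₀ X₁ : C} (d : X₀ ⟶ X₁) [Mono d] (m : M.obj X₁)
    (hm : ∀ (W : C) (k : X₁ ⟶ W), d ≫ k = 0 → M.map k m = 0) :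
    ∃ a, M.map d a = m := by
  have := hM.isMonoFunctor.additive
  let ι := Extension.ι hC hn M d m
  have hι : ∀ Z, Function.Injective (ι.app Z) :=
    Extension.injective_ι_app hC hn M d m hM.isMonoFunctor hm
  have (Z : C) : Mono (ι.app Z) := (AddCommGrpCat.mono_iff_injective _).2 (hι Z)
  have hp : IsMonoFunctor (cokernel ι) :=
    hM.pure _ ι (Extension.isMonoFunctor_functor hC hn M d m) (NatTrans.mono_of_mono_app ι)
  let e := Extension.mk hC hn M d m (0, 𝟙 X₀)
  -- The map `d` sends `e` into `M`, so the class of `e` in the quotient vanishes, the quotient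
  -- being a mono functor.
  obtain ⟨a, ha⟩ : ∃ a, ι.app X₀ a = e := by
    rw [← cokernel_π_app_eq_zero_iff]
    apply hp.injective_map d
    rw [← NatTrans.naturality_apply, map_zero, cokernel_π_app_eq_zero_iff]
    exact ⟨m, (Extension.functor_map_mk_id hC hn M d m).symm⟩
  refine ⟨a, hι _ ?_⟩
  rw [NatTrans.naturality_apply, ha]
  exact Extension.functor_map_mk_id hC hn M d m

end

end NAbelian

theorem theorem4p2 (n : ℕ) (hn : 0 < n) (C : Type u) [SmallCategory C] [Preadditive C]
    (hC : NAbelian.IsNAbelian n C) (M : C ⥤ Ab.{u}) (hM : NAbelian.IsMonoFunctor M) :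
    NAbelian.IsAbsolutelyPure M ↔
      ∀ X : ComposableArrows C (n + 1), NAbelian.IsLeftNExact X →
        Function.Injective (M.map (X.map' 0 1 (by omega) (by omega))) ∧
        Function.Exact (M.map (X.map' 0 1 (by omega) (by omega)))
          (M.map (X.map' 1 2 (by omega) (by omega))) := by
  refine ⟨fun h X hX ↦ ?_, fun h ↦ ⟨hM, fun N ι hN hι ↦
    NAbelian.isPureSubfunctor_of_exact hN ι fun {A B} f hf ↦ ?_⟩⟩
  swap
  · obtain ⟨X, hX, hl⟩ := hC.exists_nExact_of_mono f
    let P : Arrow C → Prop := fun φ ↦ ∃ (W : C) (p : φ.right ⟶ W), φ.hom ≫ p = 0 ∧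
      Function.Exact (M.map φ.hom) (M.map p)
    suffices P (Arrow.mk f) from this
    rw [← hX]
    exact ⟨X.obj' 2, X.map' 1 2,
      (hl.1.exact _ 0 hn (X.map' 0 1)).2 ⟨𝟙 _, Category.id_comp _⟩, (h X hl.1).2⟩
  have := hM.additive
  have hd : Mono (X.map' 0 1 (by omega) (by omega)) := ⟨fun a b e ↦ hX.injective _ e⟩
  have hz : X.map' 0 1 (by omega) (by omega) ≫ X.map' 1 2 (by omega) (by omega) = 0 :=
    (hX.exact _ 0 hn (X.map' 0 1 (by omega) (by omega))).2 ⟨𝟙 _, Category.id_comp _⟩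
  refine ⟨hM.injective_map _, fun m ↦ ⟨fun hm ↦ ?_, ?_⟩⟩
  · exact h.exists_map_eq hC hn _ m fun W k hk ↦
      hM.map_eq_zero hC hn _ _ (fun Z z ↦ hX.exact Z 0 hn z) m hm k hk
  · rintro ⟨a, rfl⟩
    rw [← ConcreteCategory.comp_apply, ← M.map_comp, hz, M.map_zero]
    rfl
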